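/- Let $q=e^{2\pi i\tau}$, $\tau\in\mathbb H$. Let $E_2,E_4,E_6$ be the Eisenstein series of level one with constant term $1$, let $\Delta=\tfrac1{1728}(E_4^3-E_6^2)$, and put $$\lambda(\tau)=\frac{\Delta(2\tau)}{\Delta(\tau)},\qquad g(\tau)=E_4(\tau)-2^4E_4(2\tau),\qquad W=\begin{pmatrix}0&-1\\2&0\end{pmatrix}.$$ For even $k$ and $\gamma=\begin{pmatrix}a&b\\c&d\end{pmatrix}$ with $\det\gamma>0$ write $(f|_k\gamma)(\tau)=(\det\gamma)^{k/2}(c\tau+d)^{-k}f(\gamma\tau)$, and let $U_2$ be the operator $\sum_i a_iq^i\mapsto\sum_i a_{2i}q^i$ on Laurent series in $q$. For integers $n,m\ge1$ the function $(\lambda^ng^{3\cdot2^m})|_{12\cdot2^m}W$ on $\mathbb H$ is the sum of a Laurent series in $q$ with finitely many terms of negative exponent, and Serre's trace sequence is $$\lambda_{n,m}=\lambda^ng^{3\cdot2^m}+2^{1-6\cdot2^m}\left(\left(\lambda^ng^{3\cdot2^m}\right)\big|_{12\cdot2^m}W\right)\big|\,U_2 .$$ Let $\mathcal D_r f=\frac1{2\pi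 i}\frac{df}{d\tau}-\frac r{12}E_2f$ and $\mathcal D_r^j=\mathcal D_{r+2(j-1)}\circ\cdots\circ\mathcal D_{r+2}\circ\mathcal D_r$. **Proposition.** For all integers $n,m\ge1$, the function $f=\Delta^n\lambda_{n,m}$ is a modular form of level one and weight $k=12\cdot2^m+12n$, and with $t=2^m-n$ it satisfies the third-order modular linear differential equation $$\mathcal D_k^3f=\left(\tfrac34t^2+\tfrac14t+\tfrac1{18}\right)E_4\,\mathcal D_kf-\tfrac14\left(t^3+t^2\right)E_6\,f .$$ In particular the order of the equation is three, whatever the weight $k$. -/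

import Mathlib

open UpperHalfPlane
open scoped MatrixGroups

noncomputable section

namespace SerreTrace

/-- The nome `q = exp (2 π i τ)`. -/
def nome (τ : ℍ) : ℂ := Complex.exp (2 * Real.pi * Complex.I * (τ : ℂ))

/-- The point `p τ` of the upper half-plane (that is, the substitution `q ↦ q ^ p`). -/
def scale (p : ℕ) [NeZero p] (τ : ℍ) : ℍ :=
  (⟨(p : ℝ), Nat.cast_pos.mpr (NeZero.pos p)⟩ : {x : ℝ // 0 < x}) • τ

/-- `f` is given on the whole upper half-plane by the Laurent series `∑ i, a i * q ^ i`, which has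
finitely many terms of negative exponent. -/
def HasLaurentQExpansion (f : ℍ → ℂ) (a : ℤ → ℂ) : Prop :=
  (∃ N : ℤ, ∀ i < N, a i = 0) ∧ ∀ τ : ℍ, HasSum (fun i : ℤ ↦ a i * nome τ ^ i) (f τ)

open Classical in
/-- The coefficients of the Laurent `q`-expansion of `f` (`0` if there is no such expansion). -/
def qCoeff (f : ℍ → ℂ) : ℤ → ℂ :=
  if h : ∃ a, HasLaurentQExpansion f a then h.choose else 0

/-- The operator `U_p` on `q`-series: `∑ i, a i * q ^ i` goes to `∑ i, a (p * i) * q ^ i`. -/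
def opU (p : ℕ) (f : ℍ → ℂ) (τ : ℍ) : ℂ := ∑' i : ℤ, qCoeff f (p * i) * nome τ ^ i

/-- The slash operator of weight `k`, normalised by `det ^ (k / 2)` (so that scalar matrices act
trivially for even `k`); it is used for matrices of positive determinant. -/
def normSlash (k : ℤ) (γ : GL (Fin 2) ℝ) (f : ℍ → ℂ) (τ : ℍ) : ℂ :=
  ((γ.det.val ^ ((k : ℝ) / 2) : ℝ) : ℂ) * (UpperHalfPlane.denom γ τ) ^ (-k) * f (γ • τ)

/-- The matrix `W = (0, -1; 2, 0)`. -/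
def matW : GL (Fin 2) ℝ :=
  Matrix.GeneralLinearGroup.mkOfDetNeZero !![0, -1; 2, 0] (by simp [Matrix.det_fin_two])

/-- `λ(τ) = Δ(2τ) / Δ(τ)`. -/
def lam (τ : ℍ) : ℂ := ModularForm.discriminant (scale 2 τ) / ModularForm.discriminant τ

/-- `g(τ) = E₄(τ) - 2 ^ 4 E₄(2τ)`. -/
def formG (τ : ℍ) : ℂ := ModularForm.E₄ τ - 2 ^ 4 * ModularForm.E₄ (scale 2 τ)

/-- `λ ^ n g ^ (3 * 2 ^ m)`, of weight `12 * 2 ^ m` on `Γ₀(2)`. -/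
def preTrace (n m : ℕ) (τ : ℍ) : ℂ := lam τ ^ n * formG τ ^ (3 * 2 ^ m)

/-- The function `(λ ^ n g ^ (3 * 2 ^ m)) ∣ W`, the slash operator being of weight `12 * 2 ^ m`. -/
def preTraceW (n m : ℕ) : ℍ → ℂ := normSlash (12 * 2 ^ m) matW (preTrace n m)

/-- Serre's sequence
`λ_{n,m} = λ ^ n g ^ (3 * 2 ^ m) + 2 ^ (1 - 6 * 2 ^ m) ((λ ^ n g ^ (3 * 2 ^ m)) ∣ W) ∣ U_2`. -/
def lamSeq (n m : ℕ) (τ : ℍ) : ℂ :=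
  preTrace n m τ + (2 : ℂ) ^ (1 - 6 * 2 ^ m : ℤ) * opU 2 (preTraceW n m) τ

/-- `Δ ^ n λ_{n,m}`. -/
def deltaLam (n m : ℕ) (τ : ℍ) : ℂ := ModularForm.discriminant τ ^ n * lamSeq n m τ

/-- The iterates of the Ramanujan-Serre derivative `D_r f = θ f - (r / 12) E₂ f`:
`D_r ^ j = D_{r + 2 (j - 1)} ∘ ⋯ ∘ D_{r + 2} ∘ D_r`. -/
def serreIter (r : ℂ) : ℕ → (ℍ → ℂ) → ℍ → ℂ
  | 0, f => f
  | j + 1, f => Derivative.serreDerivative (r + 2 * j) (serreIter r j f)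

lemma nome_ne_zero (τ : ℍ) : nome τ ≠ 0 := Complex.exp_ne_zero _

lemma exists_nome_eq {z : ℂ} (hz : z ≠ 0) (h1 : ‖z‖ < 1) : ∃ τ : ℍ, nome τ = z := by
  have him : 0 < (Function.Periodic.invQParam 1 z).im :=
    Function.Periodic.im_invQParam_pos_of_norm_lt_one one_pos h1 hz
  refine ⟨⟨_, him⟩, ?_⟩
  have := Function.Periodic.qParam_right_inv (h := 1) one_ne_zero hz
  simpa [nome, Function.Periodic.qParam] using this

/-- The Laurent `q`-expansion is unique. -/
lemma HasLaurentQExpansion.unique {f : ℍ → ℂ} {a b : ℤ → ℂ} (ha : HasLaurentQExpansion f a)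
    (hb : HasLaurentQExpansion f b) : a = b := by
  obtain ⟨⟨N, hN⟩, ha⟩ := ha
  obtain ⟨⟨N', hN'⟩, hb⟩ := hb
  by_contra hne
  have hex : ∃ j : ℕ, a (min N N' + j) - b (min N N' + j) ≠ 0 := by
    by_contra! hall
    refine hne (funext fun i ↦ ?_)
    by_cases hi : i < min N N'
    · rw [hN i (by omega), hN' i (by omega)]
    · have := hall (i - min N N').toNat
      rw [Int.toNat_of_nonneg (by omega)] at this
      exact sub_eq_zero.mp (by simpa using this)
  classical
  set k : ℤ := min N N' + (Nat.find hex : ℤ) with hk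
  have hlow : ∀ i < k, a i - b i = 0 := by
    intro i hi
    by_cases hi' : i < min N N'
    · rw [hN i (by omega), hN' i (by omega), sub_zero]
    · have := Nat.find_min hex (m := (i - min N N').toNat) (by omega)
      rw [Int.toNat_of_nonneg (by omega)] at this
      simpa using this
  have hsum : ∀ z : ℂ, z ≠ 0 → ‖z‖ < 1 →
      HasSum (fun j : ℕ ↦ z ^ j * (a (k + j) - b (k + j))) 0 := by
    intro z hz h1
    obtain ⟨τ, rfl⟩ := exists_nome_eq hz h1
    have h := ((ha τ).sub (hb τ)).mul_left (nome τ ^ (-k))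
    rw [sub_self, mul_zero] at h
    have hinj : Function.Injective (fun j : ℕ ↦ k + (j : ℤ)) := fun x y h ↦ by simpa using h
    rw [← hinj.hasSum_iff] at h
    · refine h.congr_fun fun j ↦ ?_
      simp only [Function.comp_apply, zpow_add₀ hz, zpow_neg, zpow_natCast]
      field_simp
    · intro i hi
      have : i < k := by
        by_contra hik
        exact hi ⟨(i - k).toNat, by simp only []; omega⟩
      rw [← sub_mul, hlow i this]
      simp
  have hp : HasFPowerSeriesAt (fun z : ℂ ↦ if z = 0 then a k - b k else 0)
      (FormalMultilinearSeries.ofScalars ℂ fun j : ℕ ↦ a (k + j) - b (k + j)) 0 := by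
    rw [hasFPowerSeriesAt_iff]
    filter_upwards [Metric.ball_mem_nhds (0 : ℂ) one_pos] with z hz
    simp only [FormalMultilinearSeries.coeff_ofScalars, zero_add, smul_eq_mul]
    by_cases h0 : z = 0
    · subst h0
      simpa using hasSum_single (f := fun j : ℕ ↦ (0 : ℂ) ^ j * (a (k + j) - b (k + j))) 0
        (fun j hj ↦ by simp [hj])
    · simpa [h0] using hsum z h0 (by simpa using hz)
  have ht := (hp.continuousAt.tendsto).mono_left (nhdsWithin_le_nhds (s := {0}ᶜ))
  have h0 : Filter.Tendsto (fun z : ℂ ↦ if z = 0 then a k - b k else 0)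
      (nhdsWithin 0 {0}ᶜ) (nhds 0) := by
    refine tendsto_const_nhds.congr' ?_
    filter_upwards [self_mem_nhdsWithin] with z hz
    simp [show z ≠ 0 from hz]
  have := tendsto_nhds_unique ht h0
  simp only [if_true] at this
  exact Nat.find_spec hex this

lemma HasLaurentQExpansion.qCoeff_eq {f : ℍ → ℂ} {a : ℤ → ℂ} (ha : HasLaurentQExpansion f a) :
    qCoeff f = a := by
  have h : ∃ a, HasLaurentQExpansion f a := ⟨a, ha⟩
  rw [qCoeff, dif_pos h]
  exact h.choose_spec.unique ha

end SerreTrace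

end

namespace SerreTrace

open Filter Topology Manifold EisensteinSeries ModularForm Derivative

/-- `F` is holomorphic and its normalised derivative `(2 π i)⁻¹ dF/dτ` is `F'`. -/
def HasNormDeriv (F F' : ℍ → ℂ) : Prop :=
  ∀ τ : ℍ, HasDerivAt (F ∘ ofComplex) (2 * Real.pi * Complex.I * F' τ) τ

namespace HasNormDeriv

variable {F F' G G' : ℍ → ℂ}

lemma two_pi_I_ne_zero : (2 * Real.pi * Complex.I : ℂ) ≠ 0 := Complex.two_pi_I_ne_zero

lemma congr' (h : HasNormDeriv F F') (hF : ∀ τ, G τ = F τ) (hF' : ∀ τ, G' τ = F' τ) :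
    HasNormDeriv G G' := by
  obtain rfl : G = F := funext hF
  obtain rfl : G' = F' := funext hF'
  exact h

lemma mdifferentiable (h : HasNormDeriv F F') : MDiff F := fun τ ↦
  UpperHalfPlane.mdifferentiableAt_iff.mpr (h τ).differentiableAt

lemma eq_deriv (h : HasNormDeriv F F') (τ : ℍ) : Derivative.normalizedDerivOfComplex F τ = F' τ := by
  rw [Derivative.normalizedDerivOfComplex, (h τ).deriv, inv_mul_cancel_left₀ two_pi_I_ne_zero]

lemma of_mdifferentiable (h : MDiff F) :
    HasNormDeriv F (Derivative.normalizedDerivOfComplex F) := fun τ ↦ by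
  rw [Derivative.normalizedDerivOfComplex, mul_inv_cancel_left₀ two_pi_I_ne_zero]
  exact (UpperHalfPlane.mdifferentiableAt_iff.mp (h τ)).hasDerivAt

lemma unique (h : HasNormDeriv F F') (h' : HasNormDeriv F G') (τ : ℍ) : F' τ = G' τ := by
  rw [← h.eq_deriv, h'.eq_deriv]

lemma serreDerivative_eq (h : HasNormDeriv F F') (k : ℂ) (τ : ℍ) :
    Derivative.serreDerivative k F τ = F' τ - k / 12 * EisensteinSeries.E2 τ * F τ := by
  rw [Derivative.serreDerivative_apply, h.eq_deriv, div_eq_mul_inv]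

lemma const (c : ℂ) : HasNormDeriv (fun _ ↦ c) (fun _ ↦ 0) := fun τ ↦ by
  simpa using! hasDerivAt_const (τ : ℂ) c

lemma add (hF : HasNormDeriv F F') (hG : HasNormDeriv G G') :
    HasNormDeriv (fun τ ↦ F τ + G τ) (fun τ ↦ F' τ + G' τ) := fun τ ↦ by
  have := (hF τ).add (hG τ)
  rw [← mul_add] at this
  exact this

lemma sub (hF : HasNormDeriv F F') (hG : HasNormDeriv G G') :
    HasNormDeriv (fun τ ↦ F τ - G τ) (fun τ ↦ F' τ - G' τ) := fun τ ↦ by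
  have := (hF τ).sub (hG τ)
  rw [← mul_sub] at this
  exact this

lemma mul (hF : HasNormDeriv F F') (hG : HasNormDeriv G G') :
    HasNormDeriv (fun τ ↦ F τ * G τ) (fun τ ↦ F' τ * G τ + F τ * G' τ) := fun τ ↦ by
  have := (hF τ).mul (hG τ)
  simp only [Function.comp_apply, ofComplex_apply] at this
  convert! this using 1
  ring

lemma const_mul (c : ℂ) (hF : HasNormDeriv F F') :
    HasNormDeriv (fun τ ↦ c * F τ) (fun τ ↦ c * F' τ) :=
  ((const c).mul hF).congr' (fun _ ↦ rfl) (fun τ ↦ by ring)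

lemma zpow (hF : HasNormDeriv F F') (h0 : ∀ τ, F τ ≠ 0) (n : ℤ) :
    HasNormDeriv (fun τ ↦ F τ ^ n) (fun τ ↦ n * F τ ^ (n - 1) * F' τ) := fun τ ↦ by
  have h1 : (F ∘ ofComplex) τ ≠ 0 := by simpa using h0 τ
  have := (hasDerivAt_zpow n _ (Or.inl h1)).comp (τ : ℂ) (hF τ)
  simp only [Function.comp_apply, ofComplex_apply] at this
  convert! this using 1
  ring

lemma pow (hF : HasNormDeriv F F') (n : ℕ) :
    HasNormDeriv (fun τ ↦ F τ ^ n) (fun τ ↦ n * F τ ^ (n - 1) * F' τ) := fun τ ↦ by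
  have := (hF τ).pow n
  simp only [Function.comp_apply, ofComplex_apply] at this
  convert! this using 1
  ring

end HasNormDeriv

/-- The affine map `τ ↦ a τ + b` of the upper half-plane. -/
noncomputable def affine (a : {x : ℝ // 0 < x}) (b : ℝ) (τ : ℍ) : ℍ := b +ᵥ a • τ

@[simp]
lemma coe_affine (a : {x : ℝ // 0 < x}) (b : ℝ) (τ : ℍ) :
    (affine a b τ : ℂ) = b + (a : ℝ) * τ := by
  simp [affine]

@[simp]
lemma im_affine (a : {x : ℝ // 0 < x}) (b : ℝ) (τ : ℍ) : (affine a b τ).im = a * τ.im := by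
  simp [affine]

lemma HasNormDeriv.comp_affine {F F' : ℍ → ℂ} (hF : HasNormDeriv F F') (a : {x : ℝ // 0 < x})
    (b : ℝ) : HasNormDeriv (fun τ ↦ F (affine a b τ)) (fun τ ↦ (a : ℝ) * F' (affine a b τ)) := by
  intro τ
  have h1 : HasDerivAt (fun z : ℂ ↦ (b : ℂ) + (a : ℝ) * z) ((a : ℝ) : ℂ) τ := by
    simpa using ((hasDerivAt_id (τ : ℂ)).const_mul ((a : ℝ) : ℂ)).const_add (b : ℂ)
  have h2 := hF (affine a b τ)
  rw [coe_affine] at h2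
  have h3 := (h2.comp (τ : ℂ) h1).congr_of_eventuallyEq
    (f₁ := (fun τ ↦ F (affine a b τ)) ∘ ofComplex) ?_
  · convert! h3 using 1
    ring
  · filter_upwards [isOpen_upperHalfPlaneSet.mem_nhds τ.im_pos] with z hz
    have hz' : 0 < z.im := hz
    simp only [Function.comp_apply, ofComplex_apply_of_im_pos hz']
    have : (b : ℂ) + (a : ℝ) * z = (affine a b ⟨z, hz'⟩ : ℍ) := by simp
    rw [this, ofComplex_apply]

lemma tendsto_affine (a : {x : ℝ // 0 < x}) (b : ℝ) :
    Tendsto (affine a b) atImInfty atImInfty := by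
  refine tendsto_comap_iff.mpr ?_
  have : (UpperHalfPlane.im ∘ affine a b) = fun τ ↦ (a : ℝ) * τ.im := by
    ext τ
    simp
  rw [this]
  exact tendsto_comap.const_mul_atTop a.2

/-- The normalised derivative of a function bounded at `i∞` vanishes there. -/
lemma HasNormDeriv.tendsto_zero {F F' : ℍ → ℂ} (hF : HasNormDeriv F F')
    (hb : IsBoundedAtImInfty F) : Tendsto F' atImInfty (𝓝 0) := by
  obtain ⟨M, A, hM⟩ := isBoundedAtImInfty_iff.mp hb
  have key : ∀ τ : ℍ, max A 0 + 1 ≤ τ.im / 2 → ‖F' τ‖ ≤ |M| * (τ.im / 2)⁻¹ := by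
    intro τ hτ
    have hA := le_max_left A 0
    have h0 := le_max_right A 0
    have hpos : 0 < τ.im / 2 := by linarith
    have him : ∀ z ∈ Metric.closedBall (τ : ℂ) (τ.im / 2), τ.im / 2 ≤ z.im := by
      intro z hz
      have h1 := (Complex.abs_im_le_norm (z - τ)).trans (by simpa [dist_eq_norm] using hz)
      have h2 := (abs_le.mp h1).1
      simp only [Complex.sub_im, coe_im] at h2
      linarith
    have hd : DiffContOnCl ℂ (F ∘ ofComplex) (Metric.ball (τ : ℂ) (τ.im / 2)) := by
      refine DifferentiableOn.diffContOnCl fun z hz ↦ ?_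
      have hz := him z (Metric.closure_ball_subset_closedBall hz)
      have := hF ⟨z, hpos.trans_le hz⟩
      exact this.differentiableAt.differentiableWithinAt
    have := Complex.norm_deriv_le_of_forall_mem_sphere_norm_le (C := |M|) hpos hd fun z hz ↦ by
      have hz := him z (Metric.sphere_subset_closedBall hz)
      rw [Function.comp_apply, ofComplex_apply_of_im_pos (hpos.trans_le hz)]
      exact (hM ⟨z, _⟩ (show A ≤ z.im by linarith)).trans (le_abs_self M)
    rw [(hF τ).deriv, norm_mul, div_eq_mul_inv] at this
    refine le_trans ?_ this
    refine le_mul_of_one_le_left (norm_nonneg _) ?_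
    simp only [norm_mul, Complex.norm_ofNat, Complex.norm_real, Complex.norm_I, mul_one,
      Real.norm_eq_abs, abs_of_pos Real.pi_pos]
    linarith [Real.two_le_pi]
  have him : Tendsto (fun τ : ℍ ↦ τ.im / 2) atImInfty atTop :=
    (tendsto_comap (f := UpperHalfPlane.im)).atTop_div_const two_pos
  refine squeeze_zero_norm' ((him.eventually_ge_atTop _).mono key) ?_
  simpa using (tendsto_inv_atTop_zero.comp him).const_mul |M|

lemma hasNormDeriv_discriminant : HasNormDeriv ModularForm.discriminant
    (fun τ ↦ EisensteinSeries.E2 τ * ModularForm.discriminant τ) := by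
  intro τ
  have hd := ModularForm.differentiableAt_eta_of_mem_upperHalfPlaneSet τ.im_pos
  have h := hd.hasDerivAt.pow 24
  have hl := ModularForm.logDeriv_eta_eq_E2 τ
  rw [logDeriv_apply, div_eq_iff (ModularForm.eta_ne_zero τ.im_pos)] at hl
  have h' := h.congr_of_eventuallyEq (f₁ := ModularForm.discriminant ∘ ofComplex) ?_
  · convert! h' using 1
    erw [hl]
    simp only [ModularForm.discriminant]
    push_cast
    ring
  · filter_upwards [isOpen_upperHalfPlaneSet.mem_nhds τ.im_pos] with z hz
    simp [ModularForm.discriminant, ofComplex_apply_of_im_pos hz]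

lemma coe_S_smul (τ : ℍ) : ((ModularGroup.S • τ : ℍ) : ℂ) = -(τ : ℂ)⁻¹ := by
  rw [modular_S_smul]
  simp

lemma denom_T (τ : ℍ) : denom ModularGroup.T τ = 1 := by
  rw [ModularGroup.denom_apply]
  simp [ModularGroup.T]

/-- A holomorphic function which is bounded at `i∞` and transforms correctly under `S` and `T` is a
modular form of level one. -/
lemma exists_modularForm {F : ℍ → ℂ} (k : ℤ) (hF : MDiff F)
    (hS : ∀ τ : ℍ, F (ModularGroup.S • τ) = (τ : ℂ) ^ k * F τ)
    (hT : ∀ τ : ℍ, F ((1 : ℝ) +ᵥ τ) = F τ) (hb : IsBoundedAtImInfty F) :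
    ∃ f : ModularForm 𝒮ℒ k, ⇑f = F := by
  have hS' : F ∣[k] ModularGroup.S = F := by
    ext τ
    rw [SL_slash_apply, hS, ModularGroup.denom_S, mul_right_comm, ← zpow_add₀ τ.ne_zero]
    simp
  have hT' : F ∣[k] ModularGroup.T = F := by
    ext τ
    rw [SL_slash_apply, modular_T_smul, hT, denom_T]
    simp
  have hall := SlashInvariantForm.slash_action_generators_SL2Z hS' hT'
  refine ⟨⟨⟨F, ?_⟩, hF, ?_⟩, rfl⟩
  · rintro _ ⟨γ, rfl⟩
    exact hall γ
  · intro c hc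
    rw [OnePoint.isBoundedAt_iff_forall_SL2Z hc]
    intro γ _
    change IsBoundedAtImInfty (F ∣[k] γ)
    rw [hall]
    exact hb

lemma periodic_comp_ofComplex {F : ℍ → ℂ} (hT : ∀ τ : ℍ, F ((1 : ℝ) +ᵥ τ) = F τ) :
    Function.Periodic (F ∘ ofComplex) (1 : ℝ) := by
  intro w
  by_cases! hw : 0 < w.im
  · have h1 : 0 < (w + (1 : ℝ)).im := by simpa using hw
    simp only [Function.comp_apply, ofComplex_apply_of_im_pos h1, ofComplex_apply_of_im_pos hw]
    rw [← hT ⟨w, hw⟩]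
    congr 1
    ext
    simp [add_comm]
  · have h1 : (w + (1 : ℝ)).im ≤ 0 := by simpa using hw
    rw [Function.comp_apply, Function.comp_apply, ofComplex_apply_of_im_nonpos h1,
      ofComplex_apply_of_im_nonpos hw]

lemma tendsto_qExpansion_coeff_zero {F : ℍ → ℂ} (hF : MDiff F)
    (hT : ∀ τ : ℍ, F ((1 : ℝ) +ᵥ τ) = F τ) (hb : IsBoundedAtImInfty F) :
    Tendsto F atImInfty (𝓝 ((qExpansion 1 F).coeff 0)) := by
  have hp := periodic_comp_ofComplex hT
  have ha := analyticAt_cuspFunction_zero one_pos hp hF hb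
  have h := ha.continuousAt.tendsto.comp (qParam_tendsto_atImInfty one_pos)
  have h0 : (qExpansion 1 F).coeff 0 = cuspFunction 1 F 0 := by simp [qExpansion_coeff]
  rw [h0]
  exact h.congr fun τ ↦ eq_cuspFunction τ one_ne_zero hp

lemma modularForm_S_smul {k : ℤ} (f : ModularForm 𝒮ℒ k) (τ : ℍ) :
    f (ModularGroup.S • τ) = (τ : ℂ) ^ k * f τ := by
  have h : (f : ℍ → ℂ) ∣[k] ModularGroup.S = f :=
    SlashInvariantFormClass.slash_action_eq f _ ⟨ModularGroup.S, rfl⟩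
  have h := congrFun h τ
  rw [SL_slash_apply, ModularGroup.denom_S] at h
  rw [← h, mul_comm, mul_assoc, ← zpow_add₀ τ.ne_zero]
  simp

lemma modularForm_one_vadd {k : ℤ} (f : ModularForm 𝒮ℒ k) (τ : ℍ) :
    f ((1 : ℝ) +ᵥ τ) = f τ :=
  SlashInvariantForm.vAdd_apply_of_mem_strictPeriods f τ one_mem_strictPeriods_SL

lemma modularForm_isBoundedAtImInfty {k : ℤ} (f : ModularForm 𝒮ℒ k) : IsBoundedAtImInfty f :=
  have : Fact (IsCusp OnePoint.infty 𝒮ℒ) :=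
    ⟨Subgroup.isCusp_of_mem_strictPeriods one_pos one_mem_strictPeriods_SL⟩
  ModularFormClass.bdd_at_infty f

lemma tendsto_modularForm {k : ℤ} (f : ModularForm 𝒮ℒ k) :
    Tendsto f atImInfty (𝓝 ((qExpansion 1 f).coeff 0)) :=
  tendsto_qExpansion_coeff_zero (ModularFormClass.holo f) (modularForm_one_vadd f)
    (modularForm_isBoundedAtImInfty f)

lemma tendsto_E₄ : Tendsto E₄ atImInfty (𝓝 1) := by
  have := tendsto_modularForm E₄
  rwa [E_qExpansion_coeff_zero _ ⟨2, rfl⟩] at this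

lemma tendsto_E₆ : Tendsto E₆ atImInfty (𝓝 1) := by
  have := tendsto_modularForm E₆
  rwa [E_qExpansion_coeff_zero _ ⟨3, rfl⟩] at this

lemma E2_one_vadd (τ : ℍ) : E2 ((1 : ℝ) +ᵥ τ) = E2 τ := by
  have h := congrFun (E2_slash_action ModularGroup.T) τ
  rw [SL_slash_apply, modular_T_smul, D2_T, denom_T] at h
  simpa using h

lemma tendsto_E2 : Tendsto E2 atImInfty (𝓝 1) := by
  have hb := isBoundedAtImInfty_E2
  have h := tendsto_qExpansion_coeff_zero E2_mdifferentiable E2_one_vadd hb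
  have hq (τ : ℍ) : HasSum (fun m : ℕ ↦ (if m = 0 then 1 else -24 * ArithmeticFunction.sigma 1 m : ℂ)
      • Function.Periodic.qParam 1 τ ^ m) (E2 τ) := by
    simpa only [Function.Periodic.qParam, Complex.ofReal_one, div_one] using
      hasSum_qExpansion_E2 (z := τ)
  have hs := hasFPowerSeriesOnBall_cuspFunction (f := E2) one_pos (analyticAt_cuspFunction_zero
    one_pos (periodic_comp_ofComplex E2_one_vadd) E2_mdifferentiable hb) hq
  have h0 := hs.coeff_zero 0
  rw [qExpansion_coeff, Nat.factorial_zero, Nat.cast_one, inv_one, one_mul, iteratedDeriv_zero,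
    ← h0] at h
  simpa [FormalMultilinearSeries.ofScalars] using h

/-- A modular form of level one and weight less than `12` that vanishes at `i∞` is zero. -/
lemma modularForm_eq_zero_of_tendsto {k : ℤ} (hk : k < 12) (f : ModularForm 𝒮ℒ k)
    (hf : Tendsto f atImInfty (𝓝 0)) : f = 0 := by
  have h0 : (qExpansion 1 f).coeff 0 = 0 := tendsto_nhds_unique (tendsto_modularForm f) hf
  have h1 : toCuspForm f h0 = 0 :=
    rank_zero_iff_forall_zero.mp (CuspForm.rank_eq_zero_of_weight_lt_twelve hk) _
  ext τ
  exact DFunLike.congr_fun h1 τ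

lemma eq_zero_of_levelOne {F : ℍ → ℂ} (k : ℤ) (hk : k < 12) (hF : MDiff F)
    (hS : ∀ τ : ℍ, F (ModularGroup.S • τ) = (τ : ℂ) ^ k * F τ)
    (hT : ∀ τ : ℍ, F ((1 : ℝ) +ᵥ τ) = F τ) (hlim : Tendsto F atImInfty (𝓝 0)) (τ : ℍ) :
    F τ = 0 := by
  obtain ⟨f, rfl⟩ := exists_modularForm k hF hS hT (hlim.isBigO_one ℝ)
  rw [modularForm_eq_zero_of_tendsto hk f hlim, zero_apply]

lemma E2_S_smul (τ : ℍ) :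
    E2 (ModularGroup.S • τ) = (τ : ℂ) ^ 2 * E2 τ + 12 / (2 * Real.pi * Complex.I) * τ := by
  have h := congrFun (E2_slash_action ModularGroup.S) τ
  rw [SL_slash_apply, ModularGroup.denom_S, Pi.sub_apply, Pi.smul_apply, D2_S, riemannZeta_two,
    smul_eq_mul] at h
  have h0 := τ.ne_zero
  have hpi : (Real.pi : ℂ) ≠ 0 := by exact_mod_cast Real.pi_ne_zero
  have hI := Complex.I_ne_zero
  rw [zpow_neg, ← div_eq_mul_inv, div_eq_iff (zpow_ne_zero _ h0)] at h
  rw [h]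
  field_simp
  linear_combination (-12) * Complex.I_sq

lemma E2_smul (γ : SL(2, ℤ)) (τ : ℍ) :
    E2 (γ • τ) = (denom γ τ) ^ 2 * E2 τ +
      12 / (2 * Real.pi * Complex.I) * γ 1 0 * denom γ τ := by
  have h := congrFun (E2_slash_action γ) τ
  rw [SL_slash_apply, Pi.sub_apply, Pi.smul_apply, D2, riemannZeta_two, smul_eq_mul] at h
  have h0 := denom_ne_zero γ τ
  have hpi : (Real.pi : ℂ) ≠ 0 := by exact_mod_cast Real.pi_ne_zero
  have hI := Complex.I_ne_zero
  rw [zpow_neg, ← div_eq_mul_inv, div_eq_iff (zpow_ne_zero _ h0)] at h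
  rw [h]
  field_simp
  linear_combination (-12) * (γ 1 0 : ℂ) * Complex.I_sq

lemma hasNormDeriv_coe :
    HasNormDeriv (fun τ : ℍ ↦ (τ : ℂ)) (fun _ ↦ (2 * Real.pi * Complex.I : ℂ)⁻¹) := by
  intro τ
  rw [mul_inv_cancel₀ HasNormDeriv.two_pi_I_ne_zero]
  refine (hasDerivAt_id (τ : ℂ)).congr_of_eventuallyEq ?_
  filter_upwards [isOpen_upperHalfPlaneSet.mem_nhds τ.im_pos] with z hz
  simp [ofComplex_apply_of_im_pos hz]

lemma HasNormDeriv.comp_S {F F' : ℍ → ℂ} (hF : HasNormDeriv F F') :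
    HasNormDeriv (fun τ ↦ F (ModularGroup.S • τ))
      (fun τ ↦ F' (ModularGroup.S • τ) / (τ : ℂ) ^ 2) := by
  intro τ
  have h1 : HasDerivAt (fun z : ℂ ↦ -z⁻¹) (((τ : ℂ) ^ 2)⁻¹) τ := by
    simpa using! (hasDerivAt_inv τ.ne_zero).neg
  have h2 := hF (ModularGroup.S • τ)
  rw [coe_S_smul] at h2
  have h3 := (h2.comp (τ : ℂ) h1).congr_of_eventuallyEq
    (f₁ := (fun τ ↦ F (ModularGroup.S • τ)) ∘ ofComplex) ?_
  · convert! h3 using 1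
    ring
  · filter_upwards [isOpen_upperHalfPlaneSet.mem_nhds τ.im_pos] with z hz
    have hz' : 0 < z.im := hz
    simp only [Function.comp_apply, ofComplex_apply_of_im_pos hz']
    have : -z⁻¹ = (ModularGroup.S • (⟨z, hz'⟩ : ℍ) : ℍ) := by rw [coe_S_smul]
    rw [this, ofComplex_apply]

lemma HasNormDeriv.one_vadd {F F' : ℍ → ℂ} (hF : HasNormDeriv F F')
    (hT : ∀ τ : ℍ, F ((1 : ℝ) +ᵥ τ) = F τ) (τ : ℍ) : F' ((1 : ℝ) +ᵥ τ) = F' τ := by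
  have h1 := hF.comp_affine ⟨1, one_pos⟩ 1
  have h2 (τ : ℍ) : affine ⟨1, one_pos⟩ 1 τ = (1 : ℝ) +ᵥ τ := by ext; simp
  simp only [h2, hT, Complex.ofReal_one, one_mul] at h1
  exact h1.unique hF τ

lemma HasNormDeriv.S_smul {F F' : ℍ → ℂ} (hF : HasNormDeriv F F') {k : ℤ}
    (hS : ∀ τ : ℍ, F (ModularGroup.S • τ) = (τ : ℂ) ^ k * F τ) (τ : ℍ) :
    F' (ModularGroup.S • τ) = (τ : ℂ) ^ (k + 2) * F' τ +
      k / (2 * Real.pi * Complex.I) * (τ : ℂ) ^ (k + 1) * F τ := by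
  have h1 := hF.comp_S
  simp only [hS] at h1
  have h2 := h1.unique ((hasNormDeriv_coe.zpow (fun τ ↦ τ.ne_zero) k).mul hF) τ
  have h0 := τ.ne_zero
  rw [div_eq_iff (pow_ne_zero 2 h0)] at h2
  rw [h2, zpow_add₀ h0, zpow_add₀ h0, zpow_sub₀ h0]
  field_simp
  ring

/-- If `F` and `G` have weights `k` and `k + 2` for the full modular group and the same limit at
`i∞`, and `k + 2 < 12`, then `D_k F = - (k / 12) G`. -/
lemma HasNormDeriv.of_levelOne {F G : ℍ → ℂ} {k : ℤ} (hk : k + 2 < 12) (hF : MDiff F) (hG : MDiff G)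
    (hFS : ∀ τ : ℍ, F (ModularGroup.S • τ) = (τ : ℂ) ^ k * F τ)
    (hGS : ∀ τ : ℍ, G (ModularGroup.S • τ) = (τ : ℂ) ^ (k + 2) * G τ)
    (hFT : ∀ τ : ℍ, F ((1 : ℝ) +ᵥ τ) = F τ) (hGT : ∀ τ : ℍ, G ((1 : ℝ) +ᵥ τ) = G τ)
    {c : ℂ} (hFc : Tendsto F atImInfty (𝓝 c)) (hGc : Tendsto G atImInfty (𝓝 c)) :
    HasNormDeriv F (fun τ ↦ k / 12 * (E2 τ * F τ - G τ)) := by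
  have hD := HasNormDeriv.of_mdifferentiable hF
  have hD' := HasNormDeriv.of_mdifferentiable (normalizedDerivOfComplex_mdifferentiable hF)
  have hm := (hD'.sub ((((HasNormDeriv.of_mdifferentiable E2_mdifferentiable).mul hD).sub
    (HasNormDeriv.of_mdifferentiable hG)).const_mul (k / 12 : ℂ))).mdifferentiable
  refine hD.congr' (fun _ ↦ rfl) fun τ ↦ (sub_eq_zero.mp (eq_zero_of_levelOne (k + 2) hk hm
    (fun τ ↦ ?_) (fun τ ↦ ?_) ?_ τ)).symm
  · have h0 := τ.ne_zero
    rw [hD.S_smul hFS, hFS, hGS, E2_S_smul, zpow_add₀ h0, zpow_add₀ h0]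
    have hpi : (Real.pi : ℂ) ≠ 0 := by exact_mod_cast Real.pi_ne_zero
    field_simp
    ring
  · rw [hD.one_vadd hFT, E2_one_vadd, hFT, hGT]
  · simpa using (hD.tendsto_zero (hFc.isBigO_one ℝ)).sub
      (((tendsto_E2.mul hFc).sub hGc).const_mul (k / 12 : ℂ))

lemma hasNormDeriv_E₄ : HasNormDeriv E₄ (fun τ ↦ (E2 τ * E₄ τ - E₆ τ) / 3) :=
  (HasNormDeriv.of_levelOne (k := 4) (by norm_num) (ModularFormClass.holo E₄)
    (ModularFormClass.holo E₆) (modularForm_S_smul E₄) (modularForm_S_smul E₆)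
    (modularForm_one_vadd E₄) (modularForm_one_vadd E₆) tendsto_E₄ tendsto_E₆).congr'
    (fun _ ↦ rfl) (fun τ ↦ by push_cast; ring)

lemma hasNormDeriv_E₆ : HasNormDeriv E₆ (fun τ ↦ (E2 τ * E₆ τ - E₄ τ ^ 2) / 2) :=
  (HasNormDeriv.of_levelOne (G := fun τ ↦ E₄ τ ^ 2) (k := 6) (by norm_num)
    (ModularFormClass.holo E₆) (hasNormDeriv_E₄.pow 2).mdifferentiable (modularForm_S_smul E₆)
    (fun τ ↦ by rw [modularForm_S_smul, mul_pow]; norm_cast; ring)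
    (modularForm_one_vadd E₆) (fun τ ↦ by rw [modularForm_one_vadd]) tendsto_E₆
    (by simpa using tendsto_E₄.pow 2)).congr'
    (fun _ ↦ rfl) (fun τ ↦ by push_cast; ring)

lemma hasNormDeriv_E2 : HasNormDeriv E2 (fun τ ↦ (E2 τ ^ 2 - E₄ τ) / 12) := by
  have hD := HasNormDeriv.of_mdifferentiable E2_mdifferentiable
  have hD' := HasNormDeriv.of_mdifferentiable
    (normalizedDerivOfComplex_mdifferentiable E2_mdifferentiable)
  have hm := (hD'.sub (((hD.pow 2).sub hasNormDeriv_E₄).const_mul (1 / 12 : ℂ))).mdifferentiable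
  refine hD.congr' (fun _ ↦ rfl) fun τ ↦ ?_
  have := eq_zero_of_levelOne 4 (by norm_num) hm (fun τ ↦ ?_) (fun τ ↦ ?_) ?_ τ
  · linear_combination -this
  · have h0 := τ.ne_zero
    have h1 := hD.comp_S
    simp only [E2_S_smul] at h1
    have h2 := h1.unique (((hasNormDeriv_coe.pow 2).mul hD).add
      (hasNormDeriv_coe.const_mul (12 / (2 * Real.pi * Complex.I)))) τ
    rw [div_eq_iff (pow_ne_zero 2 h0)] at h2
    rw [h2, E2_S_smul, modularForm_S_smul]
    have hpi : (Real.pi : ℂ) ≠ 0 := by exact_mod_cast Real.pi_ne_zero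
    have hI := Complex.I_ne_zero
    norm_cast
    field_simp
    push_cast
    ring
  · rw [hD.one_vadd E2_one_vadd, E2_one_vadd, modularForm_one_vadd]
  · simpa using (hD.tendsto_zero isBoundedAtImInfty_E2).sub
      (((tendsto_E2.pow 2).sub tendsto_E₄).const_mul (1 / 12 : ℂ))

/-- The positive real number `2`, acting on the upper half-plane. -/
def two : {x : ℝ // 0 < x} := ⟨2, two_pos⟩

/-- The positive real number `1 / 2`, acting on the upper half-plane. -/
noncomputable def half : {x : ℝ // 0 < x} := ⟨1 / 2, one_half_pos⟩

@[simp] lemma coe_two : (two : ℝ) = 2 := rfl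

@[simp] lemma coe_half : (half : ℝ) = 1 / 2 := rfl

/-- The matrix `(1, -1; 2, -1)`. -/
def matV : SL(2, ℤ) := ⟨!![1, -1; 2, -1], by decide⟩

lemma scale_two (τ : ℍ) : scale 2 τ = affine two 0 τ := by
  ext
  simp [scale]

lemma affine_two_S_smul (τ : ℍ) :
    affine two 0 (ModularGroup.S • τ) = ModularGroup.S • affine half 0 τ := by
  ext
  simp only [coe_affine, coe_S_smul, coe_two, coe_half]
  push_cast
  field_simp
  simp

lemma affine_half_S_smul (τ : ℍ) :
    affine half 0 (ModularGroup.S • τ) = ModularGroup.S • affine two 0 τ := by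
  ext
  simp only [coe_affine, coe_S_smul, coe_two, coe_half]
  push_cast
  field_simp
  simp
  field_simp

lemma denom_matV (τ : ℍ) : denom matV (affine half (1 / 2) τ) = τ := by
  rw [ModularGroup.denom_apply]
  simp [matV]
  ring

lemma affine_half_half_S_smul (τ : ℍ) :
    affine half (1 / 2) (ModularGroup.S • τ) = matV • affine half (1 / 2) τ := by
  ext
  have h0 := τ.ne_zero
  rw [coe_specialLinearGroup_apply]
  have h1 : (2 * (1 / 2 + 1 / 2 * (τ : ℂ)) + -1) = τ := by ring
  simp only [coe_affine, coe_S_smul, matV, coe_half]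
  simp only [Matrix.of_apply, Matrix.cons_val_zero, Matrix.cons_val_one, Matrix.cons_val',
    Matrix.cons_val_fin_one, algebraMap_int_eq, eq_intCast]
  push_cast
  rw [h1]
  field_simp
  ring

lemma affine_two_one_vadd (τ : ℍ) :
    affine two 0 ((1 : ℝ) +ᵥ τ) = (1 : ℝ) +ᵥ ((1 : ℝ) +ᵥ affine two 0 τ) := by
  ext
  simp
  ring

lemma affine_half_one_vadd (τ : ℍ) : affine half 0 ((1 : ℝ) +ᵥ τ) = affine half (1 / 2) τ := by
  ext
  simp
  ring

lemma affine_half_half_one_vadd (τ : ℍ) :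
    affine half (1 / 2) ((1 : ℝ) +ᵥ τ) = (1 : ℝ) +ᵥ affine half 0 τ := by
  ext
  simp
  ring

/-- The form `a E₂(a τ + b) - E₂(τ)`. -/
noncomputable def eisDiff (a : {x : ℝ // 0 < x}) (b : ℝ) (τ : ℍ) : ℂ :=
  (a : ℝ) * E2 (affine a b τ) - E2 τ

lemma hasNormDeriv_eisDiff (a : {x : ℝ // 0 < x}) (b : ℝ) :
    HasNormDeriv (eisDiff a b) (fun τ ↦ (a : ℝ) * ((a : ℝ) *
      ((E2 (affine a b τ) ^ 2 - E₄ (affine a b τ)) / 12)) - (E2 τ ^ 2 - E₄ τ) / 12) :=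
  ((hasNormDeriv_E2.comp_affine a b).const_mul _).sub hasNormDeriv_E2

lemma tendsto_eisDiff (a : {x : ℝ // 0 < x}) (b : ℝ) :
    Tendsto (eisDiff a b) atImInfty (𝓝 ((a : ℝ) - 1)) := by
  simpa using! ((tendsto_E2.comp (tendsto_affine a b)).const_mul ((a : ℝ) : ℂ)).sub tendsto_E2

lemma eisDiff_two_S_smul (τ : ℍ) :
    eisDiff two 0 (ModularGroup.S • τ) = (τ : ℂ) ^ 2 * eisDiff half 0 τ := by
  simp only [eisDiff, affine_two_S_smul, E2_S_smul, coe_affine, coe_two, coe_half]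
  push_cast
  ring

lemma eisDiff_half_S_smul (τ : ℍ) :
    eisDiff half 0 (ModularGroup.S • τ) = (τ : ℂ) ^ 2 * eisDiff two 0 τ := by
  simp only [eisDiff, affine_half_S_smul, E2_S_smul, coe_affine, coe_two, coe_half]
  push_cast
  ring

lemma eisDiff_half_half_S_smul (τ : ℍ) :
    eisDiff half (1 / 2) (ModularGroup.S • τ) = (τ : ℂ) ^ 2 * eisDiff half (1 / 2) τ := by
  rw [eisDiff, eisDiff, E2_S_smul]
  simp only [affine_half_half_S_smul, E2_smul, denom_matV, coe_half,
    show matV 1 0 = 2 from rfl]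
  push_cast
  ring

lemma eisDiff_two_one_vadd (τ : ℍ) : eisDiff two 0 ((1 : ℝ) +ᵥ τ) = eisDiff two 0 τ := by
  simp only [eisDiff, affine_two_one_vadd, E2_one_vadd]

lemma eisDiff_half_one_vadd (τ : ℍ) :
    eisDiff half 0 ((1 : ℝ) +ᵥ τ) = eisDiff half (1 / 2) τ := by
  simp only [eisDiff, affine_half_one_vadd, E2_one_vadd]

lemma eisDiff_half_half_one_vadd (τ : ℍ) :
    eisDiff half (1 / 2) ((1 : ℝ) +ᵥ τ) = eisDiff half 0 τ := by
  simp only [eisDiff, affine_half_half_one_vadd, E2_one_vadd]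

lemma eisDiff_sum (τ : ℍ) :
    eisDiff two 0 τ + eisDiff half 0 τ + eisDiff half (1 / 2) τ = 0 := by
  refine eq_zero_of_levelOne 2 (by norm_num) (((hasNormDeriv_eisDiff two 0).add
    (hasNormDeriv_eisDiff half 0)).add (hasNormDeriv_eisDiff half (1 / 2))).mdifferentiable
    (fun τ ↦ ?_) (fun τ ↦ ?_) ?_ τ
  · rw [eisDiff_two_S_smul, eisDiff_half_S_smul, eisDiff_half_half_S_smul]
    norm_cast
    ring
  · rw [eisDiff_two_one_vadd, eisDiff_half_one_vadd, eisDiff_half_half_one_vadd]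
    ring
  · convert ((tendsto_eisDiff two 0).add (tendsto_eisDiff half 0)).add
      (tendsto_eisDiff half (1 / 2)) using 2
    norm_num

lemma eisDiff_sum_mul (τ : ℍ) :
    eisDiff two 0 τ * eisDiff half 0 τ + eisDiff half 0 τ * eisDiff half (1 / 2) τ +
      eisDiff half (1 / 2) τ * eisDiff two 0 τ + 3 / 4 * E₄ τ = 0 := by
  have h1 := hasNormDeriv_eisDiff two 0
  have h2 := hasNormDeriv_eisDiff half 0
  have h3 := hasNormDeriv_eisDiff half (1 / 2)
  refine eq_zero_of_levelOne 4 (by norm_num) ((((h1.mul h2).add (h2.mul h3)).add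
    (h3.mul h1)).add (hasNormDeriv_E₄.const_mul (3 / 4))).mdifferentiable
    (fun τ ↦ ?_) (fun τ ↦ ?_) ?_ τ
  · rw [eisDiff_two_S_smul, eisDiff_half_S_smul, eisDiff_half_half_S_smul, modularForm_S_smul]
    norm_cast
    ring
  · rw [eisDiff_two_one_vadd, eisDiff_half_one_vadd, eisDiff_half_half_one_vadd,
      modularForm_one_vadd]
    ring
  · have t1 := tendsto_eisDiff two 0
    have t2 := tendsto_eisDiff half 0
    have t3 := tendsto_eisDiff half (1 / 2)
    convert (((t1.mul t2).add (t2.mul t3)).add (t3.mul t1)).add (tendsto_E₄.const_mul (3 / 4))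
      using 2
    norm_num

lemma eisDiff_mul (τ : ℍ) :
    eisDiff two 0 τ * eisDiff half 0 τ * eisDiff half (1 / 2) τ - 1 / 4 * E₆ τ = 0 := by
  have h1 := hasNormDeriv_eisDiff two 0
  have h2 := hasNormDeriv_eisDiff half 0
  have h3 := hasNormDeriv_eisDiff half (1 / 2)
  refine eq_zero_of_levelOne 6 (by norm_num) (((h1.mul h2).mul h3).sub
    (hasNormDeriv_E₆.const_mul (1 / 4))).mdifferentiable
    (fun τ ↦ ?_) (fun τ ↦ ?_) ?_ τ
  · rw [eisDiff_two_S_smul, eisDiff_half_S_smul, eisDiff_half_half_S_smul, modularForm_S_smul]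
    norm_cast
    ring
  · rw [eisDiff_two_one_vadd, eisDiff_half_one_vadd, eisDiff_half_half_one_vadd,
      modularForm_one_vadd]
    ring
  · have t1 := tendsto_eisDiff two 0
    have t2 := tendsto_eisDiff half 0
    have t3 := tendsto_eisDiff half (1 / 2)
    convert ((t1.mul t2).mul t3).sub (tendsto_E₆.const_mul (1 / 4)) using 2
    norm_num

/-- The defining equation of the forms `2 E₂(2τ) - E₂(τ)`, `E₂(τ/2)/2 - E₂(τ)` and
`E₂((τ+1)/2)/2 - E₂(τ)` over the ring of modular forms of level one. -/
def IsCubicRoot (e : ℍ → ℂ) : Prop := ∀ τ, 4 * e τ ^ 3 - 3 * E₄ τ * e τ - E₆ τ = 0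

lemma isCubicRoot_two : IsCubicRoot (eisDiff two 0) := fun τ ↦ by
  linear_combination 4 * eisDiff two 0 τ ^ 2 * eisDiff_sum τ - 4 * eisDiff two 0 τ *
    eisDiff_sum_mul τ + 4 * eisDiff_mul τ

lemma isCubicRoot_half : IsCubicRoot (eisDiff half 0) := fun τ ↦ by
  linear_combination 4 * eisDiff half 0 τ ^ 2 * eisDiff_sum τ - 4 * eisDiff half 0 τ *
    eisDiff_sum_mul τ + 4 * eisDiff_mul τ

lemma isCubicRoot_half_half : IsCubicRoot (eisDiff half (1 / 2)) := fun τ ↦ by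
  linear_combination 4 * eisDiff half (1 / 2) τ ^ 2 * eisDiff_sum τ -
    4 * eisDiff half (1 / 2) τ * eisDiff_sum_mul τ + 4 * eisDiff_mul τ

lemma IsCubicRoot.ne_zero {e : ℍ → ℂ} (he : IsCubicRoot e) (τ : ℍ) : E₄ τ - 4 * e τ ^ 2 ≠ 0 := by
  intro h
  have h1 := discriminant_eq_E₄_cube_sub_E₆_sq τ
  refine discriminant_ne_zero τ ?_
  rw [h1, ← sub_eq_zero.mp (he τ)]
  linear_combination (E₄ τ - e τ ^ 2) * (E₄ τ - 4 * e τ ^ 2) / 1728 * h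

lemma IsCubicRoot.hasNormDeriv {e : ℍ → ℂ} (he : IsCubicRoot e) (hm : MDiff e) :
    HasNormDeriv e (fun τ ↦ E2 τ * e τ / 6 + E₄ τ / 6 - e τ ^ 2 / 3) := by
  have hD := HasNormDeriv.of_mdifferentiable hm
  have h1 := (((hD.pow 3).const_mul 4).sub ((hasNormDeriv_E₄.const_mul 3).mul hD)).sub
    hasNormDeriv_E₆
  refine hD.congr' (fun _ ↦ rfl) fun τ ↦ ?_
  have h2 := (h1.congr' (G := fun _ ↦ 0) (fun τ ↦ (he τ).symm) (fun _ ↦ rfl)).unique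
    (HasNormDeriv.const 0) τ
  refine mul_left_cancel₀ (he.ne_zero τ) ?_
  have h3 := he τ
  norm_num at h2
  linear_combination h2 / 3 + (e τ / 3 - E2 τ / 6) * h3

lemma isBoundedAtImInfty_mul {F G : ℍ → ℂ} (hF : IsBoundedAtImInfty F)
    (hG : IsBoundedAtImInfty G) : IsBoundedAtImInfty (fun τ ↦ F τ * G τ) :=
  (boundedAtImInftySubalgebra ℂ).mul_mem hF hG

lemma isBoundedAtImInfty_pow {F : ℍ → ℂ} (hF : IsBoundedAtImInfty F) (n : ℕ) :
    IsBoundedAtImInfty (fun τ ↦ F τ ^ n) :=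
  (boundedAtImInftySubalgebra ℂ).pow_mem hF n

lemma HasNormDeriv.exists_eq_const {F : ℍ → ℂ} (hF : HasNormDeriv F (fun _ ↦ 0)) :
    ∃ c, ∀ τ, F τ = c := by
  refine ⟨F I, fun τ ↦ ?_⟩
  have h := (isOpen_upperHalfPlaneSet).is_const_of_deriv_eq_zero
    (f := F ∘ ofComplex) (Convex.isPreconnected (convex_halfSpace_im_gt 0))
    (fun z hz ↦ (hF ⟨z, hz⟩).differentiableAt.differentiableWithinAt)
    (fun z hz ↦ by simpa using (hF ⟨z, hz⟩).deriv) τ.im_pos I.im_pos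
  rw [Function.comp_apply, Function.comp_apply, ofComplex_apply, ofComplex_apply] at h
  exact h

/-- The value of the discriminant at `a τ + b`. -/
noncomputable def discAffine (a : {x : ℝ // 0 < x}) (b : ℝ) (τ : ℍ) : ℂ :=
  discriminant (affine a b τ)

lemma discAffine_ne_zero (a : {x : ℝ // 0 < x}) (b : ℝ) (τ : ℍ) : discAffine a b τ ≠ 0 :=
  discriminant_ne_zero _

lemma hasNormDeriv_discAffine (a : {x : ℝ // 0 < x}) (b : ℝ) :
    HasNormDeriv (discAffine a b) (fun τ ↦ (eisDiff a b τ + E2 τ) * discAffine a b τ) :=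
  (hasNormDeriv_discriminant.comp_affine a b).congr' (fun _ ↦ rfl)
    (fun τ ↦ by rw [eisDiff, discAffine]; ring)

lemma isBoundedAtImInfty_discAffine (a : {x : ℝ // 0 < x}) (b : ℝ) :
    IsBoundedAtImInfty (discAffine a b) :=
  discriminant_isZeroAtImInfty.isBoundedAtImInfty.comp_tendsto (tendsto_affine a b)

lemma discriminant_smul (γ : SL(2, ℤ)) (τ : ℍ) :
    discriminant (γ • τ) = denom γ τ ^ 12 * discriminant τ := by
  have h := congrFun (SlashInvariantForm.slash_action_generators_SL2Z discriminant_S_invariant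
    discriminant_T_invariant γ) τ
  rw [SL_slash_apply, zpow_neg, ← div_eq_mul_inv,
    div_eq_iff (zpow_ne_zero _ (denom_ne_zero γ τ))] at h
  rw [h, mul_comm]
  norm_cast

lemma discriminant_S_smul (τ : ℍ) :
    discriminant (ModularGroup.S • τ) = (τ : ℂ) ^ 12 * discriminant τ := by
  rw [discriminant_smul, ModularGroup.denom_S]

lemma discriminant_one_vadd (τ : ℍ) : discriminant ((1 : ℝ) +ᵥ τ) = discriminant τ := by
  rw [← modular_T_smul, discriminant_smul, denom_T, one_pow, one_mul]

lemma discAffine_two_S_smul (τ : ℍ) :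
    discAffine two 0 (ModularGroup.S • τ) = (τ : ℂ) ^ 12 * (discAffine half 0 τ / 2 ^ 12) := by
  rw [discAffine, affine_two_S_smul, discriminant_S_smul, discAffine, coe_affine, coe_half]
  push_cast
  ring

lemma discAffine_half_S_smul (τ : ℍ) :
    discAffine half 0 (ModularGroup.S • τ) = (τ : ℂ) ^ 12 * (2 ^ 12 * discAffine two 0 τ) := by
  rw [discAffine, affine_half_S_smul, discriminant_S_smul, discAffine, coe_affine, coe_two]
  push_cast
  ring

lemma discAffine_half_half_S_smul (τ : ℍ) :
    discAffine half (1 / 2) (ModularGroup.S • τ) = (τ : ℂ) ^ 12 * discAffine half (1 / 2) τ := by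
  rw [discAffine, affine_half_half_S_smul, discriminant_smul, denom_matV, discAffine]

lemma discAffine_two_one_vadd (τ : ℍ) :
    discAffine two 0 ((1 : ℝ) +ᵥ τ) = discAffine two 0 τ := by
  simp only [discAffine, affine_two_one_vadd, discriminant_one_vadd]

lemma discAffine_half_one_vadd (τ : ℍ) :
    discAffine half 0 ((1 : ℝ) +ᵥ τ) = discAffine half (1 / 2) τ := by
  simp only [discAffine, affine_half_one_vadd]

lemma discAffine_half_half_one_vadd (τ : ℍ) :
    discAffine half (1 / 2) ((1 : ℝ) +ᵥ τ) = discAffine half 0 τ := by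
  simp only [discAffine, affine_half_half_one_vadd, discriminant_one_vadd]

/-- The identity `(E₄ - 4 e²)³ Δ(aτ + b) = c Δ²`. -/
lemma IsCubicRoot.exists_discAffine_eq {a : {x : ℝ // 0 < x}} {b : ℝ}
    (he : IsCubicRoot (eisDiff a b)) : ∃ c : ℂ, c ≠ 0 ∧ ∀ τ,
      (E₄ τ - 4 * eisDiff a b τ ^ 2) ^ 3 * discAffine a b τ = c * discriminant τ ^ 2 := by
  have hx := hasNormDeriv_E₄.sub
    (((he.hasNormDeriv (hasNormDeriv_eisDiff a b).mdifferentiable).pow 2).const_mul 4)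
  have hx' := hx.congr' (fun _ ↦ rfl)
    (G' := fun τ ↦ (E2 τ - eisDiff a b τ) / 3 * (E₄ τ - 4 * eisDiff a b τ ^ 2)) fun τ ↦ by
    norm_num
    linear_combination - he τ / 3
  obtain ⟨c, hc⟩ := ((((hx'.pow 3).mul (hasNormDeriv_discAffine a b)).mul
    (hasNormDeriv_discriminant.zpow discriminant_ne_zero (-2))).congr' (fun _ ↦ rfl)
    (G' := fun _ ↦ 0) fun τ ↦ by
      have h0 := discriminant_ne_zero τ
      rw [zpow_sub_one₀ h0]
      norm_num
      field_simp
      ring).exists_eq_const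
  have key (τ : ℍ) : (E₄ τ - 4 * eisDiff a b τ ^ 2) ^ 3 * discAffine a b τ =
      c * discriminant τ ^ 2 := by
    rw [← hc τ, zpow_neg]
    have h0 := discriminant_ne_zero τ
    norm_cast
    field_simp
  refine ⟨c, ?_, key⟩
  rintro rfl
  have := key I
  simp [he.ne_zero I, discAffine_ne_zero] at this

lemma formG_eq (τ : ℍ) : formG τ = 5 * (E₄ τ - 4 * eisDiff two 0 τ ^ 2) := by
  have h := (hasNormDeriv_eisDiff two 0).unique
    (isCubicRoot_two.hasNormDeriv (hasNormDeriv_eisDiff two 0).mdifferentiable) τ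
  rw [formG, scale_two]
  have h1 : eisDiff two 0 τ = 2 * E2 (affine two 0 τ) - E2 τ := by simp [eisDiff]
  rw [h1] at h ⊢
  rw [coe_two] at h
  push_cast at h
  linear_combination 48 * h

/-- `Δ(aτ + b) ^ s Δ ^ (2 M)` is bounded at `i∞` as soon as `- s ≤ M`. -/
lemma IsCubicRoot.isBoundedAtImInfty {a : {x : ℝ // 0 < x}} {b : ℝ}
    (he : IsCubicRoot (eisDiff a b)) (M : ℕ) (s : ℤ) (hs : -s ≤ M) :
    IsBoundedAtImInfty (fun τ ↦ discriminant τ ^ (2 * M) * discAffine a b τ ^ s) := by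
  have hΔ := discriminant_isZeroAtImInfty.isBoundedAtImInfty
  rcases le_or_gt 0 s with h | h
  · lift s to ℕ using h
    simp only [zpow_natCast]
    exact isBoundedAtImInfty_mul (isBoundedAtImInfty_pow hΔ _)
      (isBoundedAtImInfty_pow (isBoundedAtImInfty_discAffine a b) _)
  · obtain ⟨r, rfl⟩ : ∃ r : ℕ, s = -r := ⟨s.natAbs, by omega⟩
    obtain ⟨j, rfl⟩ : ∃ j : ℕ, M = r + j := ⟨M - r, by omega⟩
    obtain ⟨c, hc, h1⟩ := he.exists_discAffine_eq
    have h2 : (fun τ ↦ discriminant τ ^ (2 * (r + j)) * discAffine a b τ ^ (-(r : ℤ))) =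
        fun τ ↦ (c⁻¹ * (E₄ τ - 4 * eisDiff a b τ ^ 2) ^ 3) ^ r * discriminant τ ^ (2 * j) := by
      ext τ
      have h3 : c⁻¹ * (E₄ τ - 4 * eisDiff a b τ ^ 2) ^ 3 =
          discriminant τ ^ 2 * (discAffine a b τ)⁻¹ := by
        have := discAffine_ne_zero a b τ
        field_simp
        linear_combination h1 τ
      rw [h3, mul_pow, zpow_neg, zpow_natCast]
      ring
    rw [h2]
    have h4 : IsBoundedAtImInfty fun τ ↦ c⁻¹ * (E₄ τ - 4 * eisDiff a b τ ^ 2) ^ 3 :=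
      (((tendsto_E₄.sub (((tendsto_eisDiff a b).pow 2).const_mul 4)).pow 3).const_mul
        c⁻¹).isBigO_one ℝ
    exact isBoundedAtImInfty_mul (isBoundedAtImInfty_pow h4 _) (isBoundedAtImInfty_pow hΔ _)

lemma nome_eq_qParam (τ : ℍ) : nome τ = Function.Periodic.qParam 1 τ := by
  simp [nome, Function.Periodic.qParam]

lemma hasNormDeriv_nome : HasNormDeriv nome nome := by
  intro τ
  have h : HasDerivAt (fun z : ℂ ↦ Complex.exp (2 * Real.pi * Complex.I * z))
      (2 * Real.pi * Complex.I * nome τ) τ := by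
    have := ((hasDerivAt_id (τ : ℂ)).const_mul (2 * Real.pi * Complex.I)).cexp
    simpa [nome, mul_comm] using! this
  refine h.congr_of_eventuallyEq ?_
  filter_upwards [isOpen_upperHalfPlaneSet.mem_nhds τ.im_pos] with z hz
  simp [nome, ofComplex_apply_of_im_pos hz]

lemma nome_one_vadd (τ : ℍ) : nome ((1 : ℝ) +ᵥ τ) = nome τ := by
  simp only [nome, coe_vadd, Complex.ofReal_one, mul_add, mul_one, Complex.exp_add,
    Complex.exp_two_pi_mul_I, one_mul]

lemma nome_affine_two (τ : ℍ) : nome (affine two 0 τ) = nome τ ^ 2 := by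
  rw [nome, nome, ← Complex.exp_nat_mul]
  congr 1
  simp
  ring

lemma nome_affine_half_sq (τ : ℍ) : nome (affine half 0 τ) ^ 2 = nome τ := by
  rw [nome, nome, ← Complex.exp_nat_mul]
  congr 1
  simp
  ring

lemma nome_affine_half_half (τ : ℍ) :
    nome (affine half (1 / 2) τ) = -nome (affine half 0 τ) := by
  have : (2 * Real.pi * Complex.I * (affine half (1 / 2) τ : ℂ) : ℂ) =
      2 * Real.pi * Complex.I * (affine half 0 τ : ℂ) + Real.pi * Complex.I := by
    simp
    ring
  rw [nome, nome, this, Complex.exp_add, Complex.exp_pi_mul_I, mul_neg_one]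

/-- A holomorphic function with period one and at most a pole at `i∞` has a Laurent expansion. -/
lemma exists_hasLaurentQExpansion {F : ℍ → ℂ} (hF : MDiff F)
    (hT : ∀ τ : ℍ, F ((1 : ℝ) +ᵥ τ) = F τ) (N : ℕ)
    (hb : IsBoundedAtImInfty (fun τ ↦ nome τ ^ N * F τ)) :
    ∃ a, HasLaurentQExpansion F a := by
  set G : ℍ → ℂ := fun τ ↦ nome τ ^ N * F τ with hG
  have hGm : MDiff G :=
    ((hasNormDeriv_nome.pow N).mul (HasNormDeriv.of_mdifferentiable hF)).mdifferentiable
  have hGT (τ : ℍ) : G ((1 : ℝ) +ᵥ τ) = G τ := by simp only [hG, nome_one_vadd, hT]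
  have hsum (τ : ℍ) := hasSum_qExpansion one_pos (periodic_comp_ofComplex hGT) hGm hb τ
  set c : ℕ → ℂ := fun i ↦ (qExpansion 1 G).coeff i
  refine ⟨fun i ↦ if 0 ≤ i + N then c (i + N).toNat else 0, ⟨-N, fun i hi ↦ ?_⟩, fun τ ↦ ?_⟩
  · exact if_neg (by omega)
  · have hq := nome_ne_zero τ
    have hinj : Function.Injective (fun j : ℕ ↦ (j : ℤ) - N) := fun x y h ↦ by simpa using h
    rw [← hinj.hasSum_iff]
    · have h := (hsum τ).mul_left (nome τ ^ N)⁻¹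
      rw [hG, inv_mul_cancel_left₀ (pow_ne_zero N hq)] at h
      refine h.congr_fun fun j ↦ ?_
      rw [← nome_eq_qParam, smul_eq_mul]
      simp only [Function.comp_apply, sub_add_cancel, Nat.cast_nonneg, if_true, Int.toNat_natCast,
        zpow_sub₀ hq, zpow_natCast]
      ring
    · intro i hi
      have : ¬ 0 ≤ i + N := fun h ↦ hi ⟨(i + N).toNat, by simp only []; omega⟩
      simp only [if_neg this, zero_mul]

/-- The operator `U_2` averages over the two preimages of `τ ↦ 2τ`. -/
lemma opU_two_eq {F : ℍ → ℂ} {a : ℤ → ℂ} (ha : HasLaurentQExpansion F a) (τ : ℍ) :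
    opU 2 F τ = (F (affine half 0 τ) + F (affine half (1 / 2) τ)) / 2 := by
  rw [opU, ha.qCoeff_eq]
  refine HasSum.tsum_eq ?_
  have h := ((ha.2 (affine half 0 τ)).add (ha.2 (affine half (1 / 2) τ))).div_const 2
  have hinj : Function.Injective (fun j : ℤ ↦ 2 * j) := fun x y h ↦ by simpa using h
  rw [← hinj.hasSum_iff] at h
  · refine h.congr_fun fun j ↦ ?_
    simp only [Function.comp_apply, nome_affine_half_half, Nat.cast_ofNat]
    rw [Even.neg_zpow (even_two_mul j), zpow_mul, zpow_ofNat, nome_affine_half_sq]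
    ring
  · intro i hi
    have hodd : Odd i := by
      rw [← Int.not_even_iff_odd]
      rintro ⟨j, rfl⟩
      exact hi ⟨j, by simp only []; ring⟩
    rw [nome_affine_half_half, hodd.neg_zpow]
    ring

lemma isBoundedAtImInfty_nome_div_discriminant :
    IsBoundedAtImInfty (fun τ ↦ nome τ / discriminant τ) := by
  have h : nome =O[atImInfty] discriminant := by
    refine Asymptotics.IsBigO.trans (Asymptotics.IsBigO.of_norm_left ?_) exp_isBigO_discriminant
    refine (Asymptotics.isBigO_refl _ _).congr_left fun τ ↦ ?_
    simp [nome, Complex.norm_exp]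
  exact (Asymptotics.div_isBoundedUnder_of_isBigO h).isBigO_one ℝ

lemma exists_isBoundedAtImInfty_discriminant_zpow (p : ℤ) :
    ∃ N : ℕ, IsBoundedAtImInfty (fun τ ↦ nome τ ^ N * discriminant τ ^ p) := by
  rcases le_or_gt 0 p with h | h
  · lift p to ℕ using h
    refine ⟨0, ?_⟩
    simpa using isBoundedAtImInfty_pow discriminant_isZeroAtImInfty.isBoundedAtImInfty p
  · obtain ⟨r, rfl⟩ : ∃ r : ℕ, p = -r := ⟨p.natAbs, by omega⟩
    refine ⟨r, ?_⟩
    have := isBoundedAtImInfty_pow isBoundedAtImInfty_nome_div_discriminant r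
    simpa [mul_pow, div_eq_mul_inv] using this

lemma exists_isBoundedAtImInfty_discAffine_two_zpow (p : ℤ) :
    ∃ N : ℕ, IsBoundedAtImInfty (fun τ ↦ nome τ ^ N * discAffine two 0 τ ^ p) := by
  obtain ⟨N, hN⟩ := exists_isBoundedAtImInfty_discriminant_zpow p
  refine ⟨2 * N, ?_⟩
  have := hN.comp_tendsto (tendsto_affine two 0)
  refine this.congr_left fun τ ↦ ?_
  rw [Function.comp_apply, nome_affine_two, discAffine, pow_mul]

lemma matW_smul (τ : ℍ) : matW • τ = ModularGroup.S • affine two 0 τ := by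
  ext
  rw [coe_smul_of_det_pos (by simp [matW, Matrix.det_fin_two]), coe_S_smul]
  simp [matW, num, denom, neg_div]

lemma denom_matW (τ : ℍ) : denom matW τ = 2 * τ := by
  simp [matW, denom]

lemma det_matW : (matW.det.val : ℝ) = 2 := by
  simp [matW, Matrix.det_fin_two]

lemma exists_preTrace_eq (n m : ℕ) : ∃ K : ℂ, ∀ τ, preTrace n m τ =
    K * (discriminant τ ^ (2 * 2 ^ m - n : ℤ) * discAffine two 0 τ ^ (n - 2 ^ m : ℤ)) := by
  obtain ⟨c, -, hc⟩ := isCubicRoot_two.exists_discAffine_eq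
  refine ⟨(125 * c) ^ 2 ^ m, fun τ ↦ ?_⟩
  have hA := discriminant_ne_zero τ
  have hB := discAffine_ne_zero two 0 τ
  have h1 : formG τ ^ 3 = 125 * c * (discriminant τ ^ 2 / discAffine two 0 τ) := by
    rw [formG_eq, mul_div_assoc', eq_div_iff hB]
    linear_combination 125 * hc τ
  have h2 : lam τ = discAffine two 0 τ / discriminant τ := by rw [lam, scale_two, discAffine]
  have h3 : (2 ^ m : ℤ) = ((2 ^ m : ℕ) : ℤ) := by push_cast; rfl
  rw [preTrace, h2, pow_mul, h1, zpow_sub₀ hA, zpow_sub₀ hB, h3]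
  generalize 2 ^ m = M
  generalize discriminant τ = A at *
  generalize discAffine two 0 τ = B at *
  rw [zpow_mul, zpow_natCast, zpow_natCast, zpow_natCast, zpow_natCast, mul_pow, div_pow, div_pow,
    zpow_ofNat]
  field_simp

lemma preTraceW_eq {n m : ℕ} {K : ℂ} (hK : ∀ τ, preTrace n m τ =
    K * (discriminant τ ^ (2 * 2 ^ m - n : ℤ) * discAffine two 0 τ ^ (n - 2 ^ m : ℤ))) (τ : ℍ) :
    preTraceW n m τ = K * (2 ^ (6 * 2 ^ m : ℤ) / (2 ^ 12) ^ (n - 2 ^ m : ℤ)) *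
      (discriminant τ ^ (n - 2 ^ m : ℤ) * discAffine two 0 τ ^ (2 * 2 ^ m - n : ℤ)) := by
  have hw : (2 * τ : ℂ) ^ 12 ≠ 0 := pow_ne_zero _ (mul_ne_zero two_ne_zero τ.ne_zero)
  have h1 : affine half 0 (affine two 0 τ) = τ := by
    ext
    simp
  have h2 : (((2 : ℝ) ^ (((12 * 2 ^ m : ℤ) : ℝ) / 2) : ℝ) : ℂ) = 2 ^ (6 * 2 ^ m : ℤ) := by
    have : ((12 * 2 ^ m : ℤ) : ℝ) / 2 = ((6 * 2 ^ m : ℤ) : ℝ) := by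
      push_cast
      ring
    rw [this, Real.rpow_intCast]
    push_cast
    rfl
  have h3 : (2 * τ : ℂ) ^ (-(12 * 2 ^ m) : ℤ) = ((2 * τ : ℂ) ^ 12) ^ (-(2 ^ m) : ℤ) := by
    rw [← zpow_natCast, ← zpow_mul]
    push_cast
    congr 1
    ring
  have h4 : (-(2 ^ m) : ℤ) = -(2 * 2 ^ m - n) - (n - 2 ^ m) := by ring
  have h5 : (affine two 0 τ : ℂ) = 2 * τ := by simp
  rw [preTraceW, normSlash, denom_matW, det_matW, matW_smul, hK, discriminant_S_smul,
    discAffine_two_S_smul, discAffine, h1, h2, h3, h4, h5, ← discAffine, mul_zpow, mul_zpow,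
    div_zpow, zpow_sub₀ hw, zpow_neg]
  have ha := zpow_ne_zero (2 * 2 ^ m - n : ℤ) hw
  have hb := zpow_ne_zero (n - 2 ^ m : ℤ) hw
  generalize ((2 * τ : ℂ) ^ 12) ^ (2 * 2 ^ m - n : ℤ) = X at *
  generalize ((2 * τ : ℂ) ^ 12) ^ (n - 2 ^ m : ℤ) = Y at *
  field_simp

lemma mdifferentiable_preTraceW (n m : ℕ) : MDiff (preTraceW n m) := by
  obtain ⟨K, hK⟩ := exists_preTrace_eq n m
  rw [funext (preTraceW_eq hK)]
  exact (((hasNormDeriv_discriminant.zpow discriminant_ne_zero _).mul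
    ((hasNormDeriv_discAffine two 0).zpow (discAffine_ne_zero two 0) _)).const_mul
    _).mdifferentiable

lemma exists_hasLaurentQExpansion_preTraceW (n m : ℕ) :
    ∃ a, HasLaurentQExpansion (preTraceW n m) a := by
  obtain ⟨K, hK⟩ := exists_preTrace_eq n m
  obtain ⟨N₁, h₁⟩ := exists_isBoundedAtImInfty_discriminant_zpow (n - 2 ^ m)
  obtain ⟨N₂, h₂⟩ := exists_isBoundedAtImInfty_discAffine_two_zpow (2 * 2 ^ m - n)
  refine exists_hasLaurentQExpansion (mdifferentiable_preTraceW n m) (fun τ ↦ ?_) (N₁ + N₂) ?_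
  · rw [preTraceW_eq hK, preTraceW_eq hK, discriminant_one_vadd, discAffine_two_one_vadd]
  · refine ((isBoundedAtImInfty_mul h₁ h₂).const_mul_left
      (K * (2 ^ (6 * 2 ^ m : ℤ) / (2 ^ 12) ^ (n - 2 ^ m : ℤ)))).congr_left fun τ ↦ ?_
    rw [preTraceW_eq hK, pow_add]
    ring

/-- `Δ ^ n λ_{n,m}` as the trace of a weakly holomorphic form on `Γ₀(2)`. -/
lemma exists_deltaLam_eq (n m : ℕ) : ∃ K : ℂ, ∀ τ, deltaLam n m τ =
    K * (discriminant τ ^ (2 * 2 ^ m) * discAffine two 0 τ ^ (n - 2 ^ m : ℤ)) +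
    K / (2 ^ 12) ^ (n - 2 ^ m : ℤ) *
      (discriminant τ ^ (2 * 2 ^ m) * discAffine half 0 τ ^ (n - 2 ^ m : ℤ)) +
    K / (2 ^ 12) ^ (n - 2 ^ m : ℤ) *
      (discriminant τ ^ (2 * 2 ^ m) * discAffine half (1 / 2) τ ^ (n - 2 ^ m : ℤ)) := by
  obtain ⟨K, hK⟩ := exists_preTrace_eq n m
  obtain ⟨a, ha⟩ := exists_hasLaurentQExpansion_preTraceW n m
  refine ⟨K, fun τ ↦ ?_⟩
  have hA := discriminant_ne_zero τ
  have h1 : affine two 0 (affine half 0 τ) = τ := by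
    ext
    simp
  have h2 : affine two 0 (affine half (1 / 2) τ) = (1 : ℝ) +ᵥ τ := by
    ext
    simp
    ring
  have h3 : discriminant τ ^ n * discriminant τ ^ (2 * 2 ^ m - n : ℤ) =
      discriminant τ ^ (2 * 2 ^ m) := by
    rw [← zpow_natCast, ← zpow_natCast, ← zpow_add₀ hA]
    congr 1
    push_cast
    ring
  have h4 : (2 : ℂ) ^ (1 - 6 * 2 ^ m : ℤ) * 2 ^ (6 * 2 ^ m : ℤ) = 2 := by
    rw [← zpow_add₀ two_ne_zero]
    simp
  rw [deltaLam, lamSeq, opU_two_eq ha, hK, preTraceW_eq hK, preTraceW_eq hK, ← h3]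
  have h5 : discAffine two 0 (affine half 0 τ) = discriminant τ := by rw [discAffine, h1]
  have h6 : discAffine two 0 (affine half (1 / 2) τ) = discriminant τ := by
    rw [discAffine, h2, discriminant_one_vadd]
  rw [h5, h6, ← discAffine, ← discAffine]
  generalize discriminant τ ^ (2 * 2 ^ m - n : ℤ) = P at *
  linear_combination discriminant τ ^ n * P * (K / (2 ^ 12) ^ (n - 2 ^ m : ℤ)) / 2 *
    (discAffine half 0 τ ^ (n - 2 ^ m : ℤ) + discAffine half (1 / 2) τ ^ (n - 2 ^ m : ℤ)) * h4

lemma hasNormDeriv_discriminant_pow_mul (a : {x : ℝ // 0 < x}) (b : ℝ) (N : ℕ) (s : ℤ) (c : ℂ) :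
    HasNormDeriv (fun τ ↦ c * (discriminant τ ^ N * discAffine a b τ ^ s)) (fun τ ↦
      ((N + s) * E2 τ + s * eisDiff a b τ) *
        (c * (discriminant τ ^ N * discAffine a b τ ^ s))) := by
  refine (((hasNormDeriv_discriminant.zpow discriminant_ne_zero N).mul
    ((hasNormDeriv_discAffine a b).zpow (discAffine_ne_zero a b) s)).const_mul c).congr'
    (fun τ ↦ by rw [zpow_natCast]) fun τ ↦ ?_
  have hA := discriminant_ne_zero τ
  have hB := discAffine_ne_zero a b τ
  rw [zpow_sub_one₀ hA, zpow_sub_one₀ hB, zpow_natCast]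
  push_cast
  field_simp
  ring

lemma exists_modularForm_deltaLam (n m : ℕ) :
    ∃ F : ModularForm 𝒮ℒ (12 * 2 ^ m + 12 * (n : ℤ)), ⇑F = deltaLam n m := by
  obtain ⟨K, hK⟩ := exists_deltaLam_eq n m
  refine exists_modularForm _ ?_ (fun τ ↦ ?_) (fun τ ↦ ?_) ?_
  · rw [funext hK]
    exact (((hasNormDeriv_discriminant_pow_mul two 0 _ _ _).add
      (hasNormDeriv_discriminant_pow_mul half 0 _ _ _)).add
      (hasNormDeriv_discriminant_pow_mul half (1 / 2) _ _ _)).mdifferentiable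
  · rw [hK, hK, discriminant_S_smul, discAffine_two_S_smul, discAffine_half_S_smul,
      discAffine_half_half_S_smul]
    have h0 : (τ : ℂ) ^ 12 ≠ 0 := pow_ne_zero _ τ.ne_zero
    have h1 : (τ : ℂ) ^ (12 * 2 ^ m + 12 * (n : ℤ)) =
        ((τ : ℂ) ^ 12) ^ (2 * 2 ^ m) * ((τ : ℂ) ^ 12) ^ (n - 2 ^ m : ℤ) := by
      rw [← zpow_natCast _ (2 * 2 ^ m), ← zpow_add₀ h0, ← zpow_natCast, ← zpow_mul]
      congr 1
      push_cast
      ring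
    rw [h1]
    simp only [mul_zpow, mul_pow, div_zpow]
    have h2 := zpow_ne_zero (n - 2 ^ m : ℤ) (pow_ne_zero 12 (two_ne_zero (α := ℂ)))
    field_simp
    ring
  · rw [hK, hK, discriminant_one_vadd, discAffine_two_one_vadd, discAffine_half_one_vadd,
      discAffine_half_half_one_vadd]
    ring
  · have hs : -(n - 2 ^ m : ℤ) ≤ ((2 ^ m : ℕ) : ℤ) := by
      push_cast
      omega
    rw [funext hK]
    exact (((isCubicRoot_two.isBoundedAtImInfty _ _ hs).const_mul_left _).add
      ((isCubicRoot_half.isBoundedAtImInfty _ _ hs).const_mul_left _)).add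
      ((isCubicRoot_half_half.isBoundedAtImInfty _ _ hs).const_mul_left _)

lemma serreIter_add {F G : ℍ → ℂ} (hF : MDiff F) (hG : MDiff G) (r : ℂ) (j : ℕ) :
    MDiff (serreIter r j F) ∧ MDiff (serreIter r j G) ∧
      serreIter r j (fun τ ↦ F τ + G τ) = serreIter r j F + serreIter r j G := by
  induction j with
  | zero => exact ⟨hF, hG, rfl⟩
  | succ j ih =>
    refine ⟨serreDerivative_mdifferentiable _ ih.1, serreDerivative_mdifferentiable _ ih.2.1, ?_⟩
    rw [serreIter, ih.2.2, serreDerivative_add _ _ _ ih.1 ih.2.1]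
    rfl

lemma HasNormDeriv.serreDerivative_mul_eq {f e p p₁ : ℍ → ℂ} {k s w : ℂ}
    (hf : HasNormDeriv f (fun τ ↦ (k / 12 * E2 τ + s * e τ) * f τ))
    (hp : HasNormDeriv p (fun τ ↦ w / 12 * E2 τ * p τ + p₁ τ)) :
    serreDerivative (k + w) (fun τ ↦ p τ * f τ) = fun τ ↦ (p₁ τ + s * e τ * p τ) * f τ := by
  ext τ
  rw [(hp.mul hf).serreDerivative_eq]
  ring

/-- The third-order equation satisfied by a solution of `D_k f = s e f`. -/
lemma HasNormDeriv.serreIter_three {f e : ℍ → ℂ} {k s : ℂ} (he : IsCubicRoot e) (hm : MDiff e)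
    (hf : HasNormDeriv f (fun τ ↦ (k / 12 * E2 τ + s * e τ) * f τ)) (τ : ℍ) :
    serreIter k 3 f τ = (3 / 4 * s ^ 2 - 1 / 4 * s + 1 / 18) * serreIter k 1 f τ * E₄ τ +
      1 / 4 * (s ^ 3 - s ^ 2) * f τ * E₆ τ := by
  have hD := he.hasNormDeriv hm
  have h1 : serreIter k 1 f = fun τ ↦ s * e τ * f τ := by
    ext τ
    rw [serreIter, serreIter, hf.serreDerivative_eq]
    push_cast
    ring
  have h2 : serreIter k 2 f =
      fun τ ↦ (s / 6 * E₄ τ + (s ^ 2 - s / 3) * e τ ^ 2) * f τ := by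
    rw [serreIter, h1, Nat.cast_one, mul_one, hf.serreDerivative_mul_eq (p := fun τ ↦ s * e τ)
      (p₁ := fun τ ↦ s * (E₄ τ / 6 - e τ ^ 2 / 3))
      ((hD.const_mul s).congr' (fun _ ↦ rfl) fun τ ↦ by ring)]
    ext τ
    ring
  have h3 : serreIter k 3 f = fun τ ↦
      (-s / 18 * E₆ τ + (s ^ 2 - s / 3) * (2 * e τ * (E₄ τ / 6 - e τ ^ 2 / 3)) +
        s * e τ * (s / 6 * E₄ τ + (s ^ 2 - s / 3) * e τ ^ 2)) * f τ := by
    rw [serreIter, h2, Nat.cast_ofNat, hf.serreDerivative_mul_eq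
      (p := fun τ ↦ s / 6 * E₄ τ + (s ^ 2 - s / 3) * e τ ^ 2)
      (p₁ := fun τ ↦ -s / 18 * E₆ τ + (s ^ 2 - s / 3) * (2 * e τ * (E₄ τ / 6 - e τ ^ 2 / 3)))
      (((hasNormDeriv_E₄.const_mul (s / 6)).add ((hD.pow 2).const_mul (s ^ 2 - s / 3))).congr'
        (fun _ ↦ rfl) fun τ ↦ by push_cast; ring)]
  rw [h3, h1]
  linear_combination 1 / 4 * s * (s - 1 / 3) * (s - 2 / 3) * f τ * he τ

end SerreTrace

theorem mainTheorem3 (n m : ℕ) (hn : 1 ≤ n) (hm : 1 ≤ m) :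
    (∃ a : ℤ → ℂ, SerreTrace.HasLaurentQExpansion (SerreTrace.preTraceW n m) a) ∧
    (∃ F : ModularForm 𝒮ℒ (12 * 2 ^ m + 12 * (n : ℤ)), ⇑F = SerreTrace.deltaLam n m) ∧
    ∀ k t : ℂ, k = 12 * 2 ^ m + 12 * n → t = 2 ^ m - n → ∀ τ : ℍ,
      SerreTrace.serreIter k 3 (SerreTrace.deltaLam n m) τ =
        (3 / 4 * t ^ 2 + 1 / 4 * t + 1 / 18) *
            SerreTrace.serreIter k 1 (SerreTrace.deltaLam n m) τ * ModularForm.E₄ τ -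
          1 / 4 * (t ^ 3 + t ^ 2) * SerreTrace.deltaLam n m τ * ModularForm.E₆ τ := by
  refine ⟨SerreTrace.exists_hasLaurentQExpansion_preTraceW n m,
    SerreTrace.exists_modularForm_deltaLam n m, ?_⟩
  rintro k t rfl rfl τ
  obtain ⟨K, hK⟩ := SerreTrace.exists_deltaLam_eq n m
  have hD (a : {x : ℝ // 0 < x}) (b : ℝ) (c : ℂ) :=
    (SerreTrace.hasNormDeriv_discriminant_pow_mul a b (2 * 2 ^ m) (n - 2 ^ m) c).congr'
      (fun _ ↦ rfl) (G' := fun τ ↦ ((12 * 2 ^ m + 12 * n : ℂ) / 12 * EisensteinSeries.E2 τ +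
        (n - 2 ^ m : ℂ) * SerreTrace.eisDiff a b τ) * (c * (ModularForm.discriminant τ ^ (2 * 2 ^ m)
          * SerreTrace.discAffine a b τ ^ (n - 2 ^ m : ℤ)))) fun τ ↦ by
      push_cast
      ring
  have he (a : {x : ℝ // 0 < x}) (b : ℝ) := (SerreTrace.hasNormDeriv_eisDiff a b).mdifferentiable
  have h1 := (hD SerreTrace.two 0 K).serreIter_three SerreTrace.isCubicRoot_two (he _ _) τ
  have h2 := (hD SerreTrace.half 0 (K / (2 ^ 12) ^ (n - 2 ^ m : ℤ))).serreIter_three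
    SerreTrace.isCubicRoot_half (he _ _) τ
  have h3 := (hD SerreTrace.half (1 / 2) (K / (2 ^ 12) ^ (n - 2 ^ m : ℤ))).serreIter_three
    SerreTrace.isCubicRoot_half_half (he _ _) τ
  have hadd (j : ℕ) := by
    have d1 := (hD SerreTrace.two 0 K).mdifferentiable
    have d2 := (hD SerreTrace.half 0 (K / (2 ^ 12) ^ (n - 2 ^ m : ℤ))).mdifferentiable
    have d3 := (hD SerreTrace.half (1 / 2) (K / (2 ^ 12) ^ (n - 2 ^ m : ℤ))).mdifferentiable
    have s1 := (SerreTrace.serreIter_add d1 d2 (12 * 2 ^ m + 12 * n : ℂ) j).2.2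
    have s2 := (SerreTrace.serreIter_add
      ((hD SerreTrace.two 0 K).add (hD SerreTrace.half 0 (K / (2 ^ 12) ^ (n - 2 ^ m : ℤ)))
        ).mdifferentiable d3 (12 * 2 ^ m + 12 * n : ℂ) j).2.2
    rw [s1] at s2
    exact congrFun s2 τ
  rw [hK, funext hK, hadd, hadd]
  simp only [Pi.add_apply]
  rw [h1, h2, h3]
  ring
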